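/- Let $X$ be a reduced irreducible complex space (Hausdorff, with countable topology), and let $X_{\rm reg}$ be the set of its regular points, i.e. of the points near which $X$ is a complex manifold; irreducibility means that the manifold $X_{\rm reg}$ is connected and non-empty. A holomorphic one-parameter subgroup of the group $\operatorname{Aut}_{hol}(X)$ of holomorphic automorphisms is a group homomorphism $\varphi:\mathbb{C}\to\operatorname{Aut}_{hol}(X)$, $t\mapsto\varphi_t$, such that $\mathbb{C}\times X\to X$, $(t,x)\mapsto\varphi_t(x)$, is holomorphic; in other words, it is the flow of a completely integrable (i.e. $\mathbb{C}$-complete) holomorphic vector field. The space $X$ is called holomorphically flexible if for every $x\in X_{\rm reg}$ the tangent space $T_xX$ is spanned by the tangent vectors $\frac{d}{dt}\big|_{t=0}\varphi_t(x)$, where $\varphi$ runs through all holomorphic one-parameter subgroups of $\operatorname{Aut}_{hol}(X)$. Then the following are equivalent: (1) the subgroup of $\operatorname{Aut}_{hol}(X)$ generated by all holomorphic one-parameter subgroups (the holomorphic analogue of the special automorphism group $\operatorname{SAut}(X)$) acts transitively on $X_{\rm reg}$; (3) $X$ is holomorphically flexible. In particular, if $X$ is holomorphically flexible, then $\operatorname{Aut}_{hol}(X)$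 acts transitively on $X_{\rm reg}$. -/

import Mathlib

open Set Filter Topology

/-- `A` is an analytic subset of `Ω ⊆ ℂⁿ` given by finitely many holomorphic equations on `Ω`. -/
def IsAnalyticZeroSet {n : ℕ} (Ω A : Set (Fin n → ℂ)) : Prop :=
  ∃ (k : ℕ) (f : Fin k → (Fin n → ℂ) → ℂ),
    (∀ j, AnalyticOnNhd ℂ (f j) Ω) ∧ A = {z | z ∈ Ω ∧ ∀ j, f j z = 0}

/-- Let `hol f x` say that the function `f` is a section of a given sheaf of functions near `x`.
Then `IsLocalModel hol U e Ω A` says that `e` is an isomorphism of the open set `U ⊆ X` with its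
sheaf of functions onto the analytic subset `A` of the open set `Ω ⊆ ℂⁿ` with the sheaf of functions
that are locally restrictions of holomorphic functions on the ambient `ℂⁿ`. Values of `e` outside
of `U` are irrelevant. -/
structure IsLocalModel {X : Type*} [TopologicalSpace X] (hol : (X → ℂ) → X → Prop)
    (U : Set X) {n : ℕ} (e : X → Fin n → ℂ) (Ω A : Set (Fin n → ℂ)) : Prop where
  isOpen_source : IsOpen U
  isOpen_ambient : IsOpen Ω
  analytic : IsAnalyticZeroSet Ω A
  image_eq : e '' U = A
  isEmbedding : IsEmbedding (U.domRestrict e)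
  hol_iff : ∀ x ∈ U, ∀ f : X → ℂ,
    hol f x ↔ ∃ F : (Fin n → ℂ) → ℂ, AnalyticAt ℂ F (e x) ∧ f =ᶠ[𝓝 x] fun y => F (e y)

/-- A reduced complex space structure: a sheaf of complex valued functions
(`IsHolAt f x`: the germ of `f` at `x` belongs to the stalk at `x`) which is locally
isomorphic to an analytic subset of an open subset of some `ℂⁿ` with its reduced structure sheaf.
The Hausdorff property and the countability of the topology are separate type classes. -/
class ReducedComplexSpace (X : Type*) [TopologicalSpace X] where
  IsHolAt : (X → ℂ) → X → Prop
  exists_localModel : ∀ x : X, ∃ (n : ℕ) (U : Set X) (e : X → Fin n → ℂ) (Ω A : Set (Fin n → ℂ)),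
    x ∈ U ∧ IsLocalModel IsHolAt U e Ω A

namespace ReducedComplexSpace

section Maps

variable {X Y Z : Type*} [TopologicalSpace X] [TopologicalSpace Y] [TopologicalSpace Z]
  [ReducedComplexSpace X] [ReducedComplexSpace Y] [ReducedComplexSpace Z]

/-- Holomorphic maps: continuous maps which pull back holomorphic germs to holomorphic germs. -/
def IsHolomorphic (f : X → Y) : Prop :=
  Continuous f ∧ ∀ (x : X) (g : Y → ℂ), IsHolAt g (f x) → IsHolAt (fun y => g (f y)) x

theorem IsHolomorphic.id : IsHolomorphic (fun x : X => x) :=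
  ⟨continuous_id, fun _ _ h => h⟩

theorem IsHolomorphic.comp {g : Y → Z} {f : X → Y} (hg : IsHolomorphic g)
    (hf : IsHolomorphic f) : IsHolomorphic (fun x => g (f x)) :=
  ⟨hg.1.comp hf.1, fun x k hk => hf.2 x _ (hg.2 (f x) k hk)⟩

end Maps

section Product

variable {X : Type*} [TopologicalSpace X]

theorem continuousAt_of_isLocalModel {hol : (X → ℂ) → X → Prop} {U : Set X} {n : ℕ}
    {e : X → Fin n → ℂ} {Ω A : Set (Fin n → ℂ)} (h : IsLocalModel hol U e Ω A) {x : X}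
    (hx : x ∈ U) : ContinuousAt e x :=
  (continuousOn_iff_continuous_domRestrict.2 h.isEmbedding.continuous).continuousAt
    (h.isOpen_source.mem_nhds hx)

variable [ReducedComplexSpace X]

/-- A germ of a function on `ℂ × X` is holomorphic if it is of the form `F (t, e₁ x, …, eₙ x)` with
`e₁, …, eₙ` holomorphic on `X` and `F` holomorphic on an open subset of `ℂ × ℂⁿ`. -/
def ProdIsHolAt (h : ℂ × X → ℂ) (p : ℂ × X) : Prop :=
  ∃ (n : ℕ) (e : X → Fin n → ℂ) (F : ℂ × (Fin n → ℂ) → ℂ),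
    (∀ i, IsHolAt (fun y => e y i) p.2) ∧ AnalyticAt ℂ F (p.1, e p.2) ∧
      h =ᶠ[𝓝 p] fun q => F (q.1, e q.2)

theorem analyticAt_finCons {n : ℕ} (z : ℂ × (Fin n → ℂ)) :
    AnalyticAt ℂ (fun q : ℂ × (Fin n → ℂ) => (Fin.cons q.1 q.2 : Fin (n + 1) → ℂ)) z :=
  (Fin.consEquivL ℂ fun _ : Fin (n + 1) => ℂ).toContinuousLinearMap.analyticAt z

theorem analyticAt_finUncons {n : ℕ} (z : Fin (n + 1) → ℂ) :
    AnalyticAt ℂ (fun w : Fin (n + 1) → ℂ => (w 0, Fin.tail w)) z := by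
  refine AnalyticAt.prod ?_ ?_
  · exact (ContinuousLinearMap.proj (R := ℂ) (φ := fun _ : Fin (n + 1) => ℂ) 0).analyticAt _
  · rw [analyticAt_pi_iff]
    intro i
    exact (ContinuousLinearMap.proj (R := ℂ) (φ := fun _ : Fin (n + 1) => ℂ) i.succ).analyticAt _

theorem isLocalModel_prod {U : Set X} {n : ℕ} {e : X → Fin n → ℂ} {Ω A : Set (Fin n → ℂ)}
    (h : IsLocalModel (IsHolAt (X := X)) U e Ω A) :
    IsLocalModel (ProdIsHolAt (X := X)) (univ ×ˢ U)
      (fun q => (Fin.cons q.1 (e q.2) : Fin (n + 1) → ℂ))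
      {z | Fin.tail z ∈ Ω} {z | Fin.tail z ∈ A} := by
  have htail : Continuous (fun z : Fin (n + 1) → ℂ => (Fin.tail z : Fin n → ℂ)) :=
    continuous_pi fun i => continuous_apply i.succ
  refine ⟨isOpen_univ.prod h.isOpen_source, h.isOpen_ambient.preimage htail, ?_, ?_, ?_, ?_⟩
  · obtain ⟨k, f, hf, rfl⟩ := h.analytic
    refine ⟨k, fun j z => f j (Fin.tail z), fun j z hz => ?_, rfl⟩
    exact AnalyticAt.fun_comp (f := fun w : Fin (n + 1) → ℂ => (Fin.tail w : Fin n → ℂ)) (hf j _ hz)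
      (analyticAt_snd.comp (analyticAt_finUncons z))
  · ext z
    constructor
    · rintro ⟨q, hq, rfl⟩
      show Fin.tail (Fin.cons q.1 (e q.2) : Fin (n + 1) → ℂ) ∈ A
      rw [Fin.tail_cons, ← h.image_eq]
      exact ⟨q.2, hq.2, rfl⟩
    · intro hz
      have hz' : Fin.tail z ∈ e '' U := by rw [h.image_eq]; exact hz
      obtain ⟨y, hy, hye⟩ := hz'
      refine ⟨(z 0, y), ⟨mem_univ _, hy⟩, ?_⟩
      show (Fin.cons (z 0) (e y) : Fin (n + 1) → ℂ) = z
      rw [hye, Fin.cons_self_tail]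
  · let toU : ((univ : Set ℂ) ×ˢ U : Set (ℂ × X)) → ℂ × U := fun q => (q.1.1, ⟨q.1.2, q.2.2⟩)
    have h1 : IsEmbedding toU := by
      refine IsEmbedding.of_comp (g := fun r : ℂ × U => (r.1, (r.2 : X))) (by fun_prop)
        (by fun_prop) ?_
      exact IsEmbedding.subtypeVal
    have h2 : IsEmbedding (fun r : ℂ × U => (r.1, U.domRestrict e r.2)) :=
      IsEmbedding.id.prodMap h.isEmbedding
    have h3 : IsEmbedding
        (fun q : ℂ × (Fin n → ℂ) => (Fin.cons q.1 q.2 : Fin (n + 1) → ℂ)) := by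
      refine IsEmbedding.of_comp (g := fun w : Fin (n + 1) → ℂ => (w 0, (Fin.tail w : Fin n → ℂ)))
        ?_ ((continuous_apply 0).prodMk htail) ?_
      · exact continuous_iff_continuousAt.2 fun z => (analyticAt_finCons z).continuousAt
      · exact IsEmbedding.id
    exact h3.comp (h2.comp h1)
  · rintro ⟨t, x⟩ ⟨-, hx⟩ f
    constructor
    · rintro ⟨m, a, F, ha, hF, hfF⟩
      have hcomp : ∀ i, ∃ G : (Fin n → ℂ) → ℂ, AnalyticAt ℂ G (e x) ∧
          (fun y => a y i) =ᶠ[𝓝 x] fun y => G (e y) := fun i => (h.hol_iff x hx _).1 (ha i)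
      choose G hG hGa using hcomp
      have hev : ∀ᶠ y in 𝓝 x, a y = fun i => G i (e y) := by
        filter_upwards [eventually_all.2 hGa] with y hy
        funext i
        exact hy i
      have hax : a x = fun i => G i (e x) := hev.self_of_nhds
      refine ⟨fun w => F (w 0, fun i => G i (Fin.tail w)), ?_, ?_⟩
      · refine AnalyticAt.fun_comp (g := F)
          (f := fun w : Fin (n + 1) → ℂ => (w 0, fun i => G i (Fin.tail w))) ?_ ?_
        · simpa [Fin.tail_cons, hax] using hF
        · refine (analyticAt_fst.comp (analyticAt_finUncons _)).prod ?_
          rw [analyticAt_pi_iff]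
          intro i
          refine AnalyticAt.fun_comp (g := G i)
            (f := fun w : Fin (n + 1) → ℂ => (Fin.tail w : Fin n → ℂ)) ?_
            (analyticAt_snd.comp (analyticAt_finUncons _))
          simpa [Fin.tail_cons] using hG i
      · have hev' : ∀ᶠ q : ℂ × X in 𝓝 (t, x), a q.2 = fun i => G i (e q.2) :=
          (continuous_snd.tendsto (t, x)).eventually hev
        filter_upwards [hfF, hev'] with q h1 h2
        rw [h1, h2]
        simp [Fin.tail_cons]
    · rintro ⟨F, hF, hfF⟩
      refine ⟨n, e, fun q => F (Fin.cons q.1 q.2), fun i => ?_, ?_, hfF⟩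
      · exact (h.hol_iff x hx _).2 ⟨fun z => z i,
          (ContinuousLinearMap.proj (R := ℂ) (φ := fun _ : Fin n => ℂ) i).analyticAt _,
          Eventually.of_forall fun _ => rfl⟩
      · exact AnalyticAt.fun_comp (g := F)
          (f := fun q : ℂ × (Fin n → ℂ) => (Fin.cons q.1 q.2 : Fin (n + 1) → ℂ)) hF
          (analyticAt_finCons _)

/-- The product complex space `ℂ × X`. -/
instance instProd : ReducedComplexSpace (ℂ × X) where
  IsHolAt := ProdIsHolAt
  exists_localModel := by
    rintro ⟨t, x⟩
    obtain ⟨n, U, e, Ω, A, hx, h⟩ := exists_localModel x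
    exact ⟨n + 1, univ ×ˢ U, _, _, _, ⟨mem_univ t, hx⟩, isLocalModel_prod h⟩

end Product

section Flexibility

variable (X : Type*) [TopologicalSpace X] [ReducedComplexSpace X]

variable {X} in
/-- `e` is a holomorphic coordinate system on the open set `U ⊆ X`: an isomorphism of `U` onto an
open subset of `ℂⁿ`. -/
def IsCoordinateSystem (U : Set X) {n : ℕ} (e : X → Fin n → ℂ) : Prop :=
  IsLocalModel IsHolAt U e (e '' U) (e '' U)

/-- The set `X_reg` of regular points: those near which `X` is a complex manifold. -/
def regularLocus : Set X :=
  {x | ∃ (n : ℕ) (U : Set X) (e : X → Fin n → ℂ), x ∈ U ∧ IsCoordinateSystem U e}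

/-- A reduced complex space is irreducible if its manifold of regular points is connected
(in particular non-empty). -/
def IsIrreducible : Prop := IsConnected (regularLocus X)

/-- The group of holomorphic automorphisms of `X`. -/
def HolAut : Subgroup (Equiv.Perm X) where
  carrier := {σ | IsHolomorphic (fun x => σ x) ∧ IsHolomorphic (fun x => σ.symm x)}
  mul_mem' := fun {_ _} ha hb => ⟨ha.1.comp hb.1, hb.2.comp ha.2⟩
  one_mem' := ⟨IsHolomorphic.id, IsHolomorphic.id⟩
  inv_mem' := fun {_} ha => ⟨ha.2, ha.1⟩

variable {X} in
/-- A homomorphism `φ : (ℂ, +) → Aut_hol(X)` is a holomorphic one-parameter subgroup (that is, the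
flow of a completely integrable holomorphic vector field) if `ℂ × X → X`, `(t, x) ↦ φ_t(x)` is
holomorphic. -/
def IsHolOneParam (φ : Multiplicative ℂ →* HolAut X) : Prop :=
  IsHolomorphic (fun p : ℂ × X => (φ (Multiplicative.ofAdd p.1) : Equiv.Perm X) p.2)

/-- The subgroup of `Aut_hol(X)` generated by all holomorphic one-parameter subgroups. -/
def SpecialHolAut : Subgroup (HolAut X) :=
  Subgroup.closure {g | ∃ φ : Multiplicative ℂ →* HolAut X, IsHolOneParam φ ∧ g ∈ φ.range}

variable {X} in
/-- A group of holomorphic automorphisms acts transitively on the set `S`. -/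
def ActsTransitivelyOn (G : Subgroup (HolAut X)) (S : Set X) : Prop :=
  ∀ x ∈ S, ∀ y ∈ S, ∃ g ∈ G, (g : Equiv.Perm X) x = y

variable {X} in
/-- The tangent vectors at `x` (in the coordinates `e`) of the completely integrable holomorphic
vector fields: the velocities at time `0` of the orbits of `x` under holomorphic one-parameter
subgroups. -/
def velocities {n : ℕ} (e : X → Fin n → ℂ) (x : X) : Set (Fin n → ℂ) :=
  {v | ∃ φ : Multiplicative ℂ →* HolAut X, IsHolOneParam φ ∧
    HasDerivAt (fun t : ℂ => e ((φ (Multiplicative.ofAdd t) : Equiv.Perm X) x)) v 0}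

variable {X} in
/-- A (regular) point `x` is holomorphically flexible if the tangent vectors at `x` of completely
integrable holomorphic vector fields span `T_x X`, where `T_x X` is identified with `ℂⁿ` through
any holomorphic coordinate system around `x`. -/
def IsHolFlexibleAt (x : X) : Prop :=
  ∀ (n : ℕ) (U : Set X) (e : X → Fin n → ℂ), x ∈ U → IsCoordinateSystem U e →
    Submodule.span ℂ (velocities e x) = ⊤

/-- `X` is holomorphically flexible if all of its regular points are. -/
def IsHolFlexible : Prop := ∀ x ∈ regularLocus X, IsHolFlexibleAt x

end Flexibility

end ReducedComplexSpace

/-!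
Let `G` be the group generated by the holomorphic one-parameter subgroups. The set of one-parameter
subgroups is stable under conjugation by automorphisms.

*Flexibility implies transitivity.* Let `φ₁, …, φₙ` be one-parameter subgroups whose velocities form
a basis of the tangent space at a regular point `x`. By the inverse function theorem the map
`t ↦ φ₁(t₁) ∘ ⋯ ∘ φₙ(tₙ) (x)` is a local homeomorphism at `0`, so the `G`-orbit of `x` is a
neighbourhood of `x` (`IsHolFlexibleAt.eventually_mem_orbit`). As `X_reg` is connected, there is only
one orbit.

*Transitivity implies flexibility.* Automorphisms map velocities to velocities, so by transitivity
the span `D` of the velocities has constant dimension `r` (`finrank_span_velocities_eq`).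
With `φ₁, …, φᵣ` whose velocities form a basis of `D` at `x`, and a transversal `σ` to `D`, the map
`(t, c) ↦ φ₁(t₁) ∘ ⋯ ∘ φᵣ(tᵣ) (σ c)` parametrizes a neighbourhood of `x` (`exists_isFlowBox`). Its
partial derivatives in the `tᵢ` are velocities of conjugates of the `φᵢ`, so for reasons of
dimension `D` is the tangent bundle of the plaques `c = const`, and `c` is locally constant along
the flow of every one-parameter subgroup (`IsFlowBox.eventually_snd_eq`).

Countably many translates of this flow box cover `X_reg`. A plaque of one of them meets only
countably many plaques of another one (`IsFlowBox.eventually_snd_smul_eq`, with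
`countable_image_of_eventually_eq`), so the points which can be reached from `x` by finite chains of
plaques lie on countably many plaques (`exists_countable_leaf`). This set of points is `G`-invariant,
hence contains `X_reg` if `G` acts transitively. So the transversal is countable, hence a point, and
`D` is the whole tangent space.
-/

/-! ### Locally constant functions and countable leaves -/

/-- A function which is locally constant along a preconnected set is constant on it. -/
theorem IsPreconnected.eq_of_eventually_eq {α β : Type*} [TopologicalSpace α] {S : Set α}
    (hS : IsPreconnected S) {f : α → β} (hf : ∀ x ∈ S, ∀ᶠ y in 𝓝[S] x, f y = f x) {x y : α}
    (hx : x ∈ S) (hy : y ∈ S) : f x = f y := by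
  let _ : TopologicalSpace β := ⊥
  have _ : DiscreteTopology β := ⟨rfl⟩
  refine hS.constant (fun z hz => ?_) hx hy
  exact (continuousWithinAt_const (b := f z)).congr_of_eventuallyEq (hf z hz) rfl

/-- In a product of sets `B i`, a function which is constant in each variable is constant. -/
theorem eq_of_forall_update_eq {ι β : Type*} [Finite ι] {α : ι → Type*} [DecidableEq ι]
    {B : ∀ i, Set (α i)} {f : (∀ i, α i) → β}
    (hf : ∀ t ∈ Set.pi univ B, ∀ i, ∀ u ∈ B i, f (Function.update t i u) = f t)
    {t t' : ∀ i, α i} (ht : t ∈ Set.pi univ B) (ht' : t' ∈ Set.pi univ B) : f t' = f t := by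
  have := Fintype.ofFinite ι
  have key : ∀ S : Finset ι, S.piecewise t' t ∈ Set.pi univ B ∧ f (S.piecewise t' t) = f t := by
    intro S
    induction S using Finset.induction_on with
    | empty => simpa using ht
    | insert i S hi ih =>
      have hup : (insert i S).piecewise t' t = Function.update (S.piecewise t' t) i (t' i) := by
        rw [Finset.piecewise_insert]
      rw [hup]
      refine ⟨fun j hj => ?_, ?_⟩
      · rcases eq_or_ne j i with rfl | hji
        · simpa using ht' j hj
        · simpa [hji] using ih.1 j hj
      · rw [hf _ ih.1 i _ (ht' i (mem_univ i)), ih.2]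
  simpa using (key Finset.univ).2

/-- Let countably many sets `V i` be foliated by the fibres ("plaques") of functions `s i`. If each
plaque of `V i` meets only countably many plaques of `V j`, then the leaf of a point `x`, made up of
all points reached by finite chains of plaques, consists of countably many plaques. -/
theorem exists_countable_leaf {X ι T : Type*} [Countable ι] {V : ι → Set X} {s : ι → X → T}
    (hs : ∀ i j c, (s j '' {z | z ∈ V i ∧ z ∈ V j ∧ s i z = c}).Countable) (x : X) :
    ∃ L : Set X, x ∈ L ∧ (∀ j, (s j '' (L ∩ V j)).Countable) ∧
      ∀ j, ∀ y ∈ V j, ∀ z ∈ V j, s j y = s j z → y ∈ L → z ∈ L := by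
  let step : Set X → Set X := fun A => {z | ∃ j, ∃ y ∈ A, y ∈ V j ∧ z ∈ V j ∧ s j y = s j z}
  have hstep : ∀ A : Set X, (∀ j, (s j '' (A ∩ V j)).Countable) →
      ∀ j, (s j '' (step A ∩ V j)).Countable := by
    intro A hA j
    have hsub : s j '' (step A ∩ V j) ⊆
        ⋃ i, ⋃ c ∈ s i '' (A ∩ V i), s j '' {z | z ∈ V i ∧ z ∈ V j ∧ s i z = c} := by
      rintro _ ⟨z, ⟨⟨i, y, hyA, hyi, hzi, hyz⟩, hzj⟩, rfl⟩
      exact mem_iUnion.2 ⟨i, mem_biUnion (mem_image_of_mem (s i) ⟨hyA, hyi⟩)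
        (mem_image_of_mem (s j) ⟨hzi, hzj, hyz.symm⟩)⟩
    exact (countable_iUnion fun i => (hA i).biUnion fun c _ => hs i j c).mono hsub
  let A : ℕ → Set X := fun k => step^[k] {x}
  have hA : ∀ k j, (s j '' (A k ∩ V j)).Countable := by
    intro k
    induction k with
    | zero => exact fun j => ((countable_singleton x).mono inter_subset_left).image _
    | succ k ih =>
      simp only [A, Function.iterate_succ_apply']
      exact hstep _ ih
  refine ⟨⋃ k, A k, mem_iUnion.2 ⟨0, rfl⟩, fun j => ?_, ?_⟩
  · rw [iUnion_inter, image_iUnion]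
    exact countable_iUnion fun k => hA k j
  · rintro j y hy z hz hyz hyL
    obtain ⟨k, hk⟩ := mem_iUnion.1 hyL
    refine mem_iUnion.2 ⟨k + 1, ?_⟩
    simp only [A, Function.iterate_succ_apply']
    exact ⟨j, y, hk, hy, hz, hyz⟩

/-- A function which is locally constant on a subset of a second countable space takes only
countably many values there. -/
theorem countable_image_of_eventually_eq {X T : Type*} [TopologicalSpace X]
    [SecondCountableTopology X] {S : Set X} {f : X → T}
    (hf : ∀ x ∈ S, ∀ᶠ y in 𝓝[S] x, f y = f x) : (f '' S).Countable := by
  obtain ⟨t, -, ht, hcov⟩ := TopologicalSpace.countable_cover_nhdsWithin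
    (f := fun x => {y | f y = f x}) hf
  refine (ht.image f).mono ?_
  rintro _ ⟨y, hy, rfl⟩
  obtain ⟨x, hx, hyx⟩ := mem_iUnion₂.1 (hcov hy)
  exact ⟨x, hx, hyx.symm⟩

/-! ### Charts and one-parameter subgroups -/

theorem IsLocalModel.isHolAt_apply {X : Type*} [TopologicalSpace X] {hol : (X → ℂ) → X → Prop}
    {U : Set X} {n : ℕ} {e : X → Fin n → ℂ} {Ω A : Set (Fin n → ℂ)} (h : IsLocalModel hol U e Ω A) {x : X}
    (hx : x ∈ U) (i : Fin n) : hol (fun y => e y i) x :=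
  (h.hol_iff x hx _).2 ⟨fun z => z i,
    (ContinuousLinearMap.proj (R := ℂ) (φ := fun _ : Fin n => ℂ) i).analyticAt _,
    Eventually.of_forall fun _ => rfl⟩

namespace ReducedComplexSpace

variable {X Y : Type*} [TopologicalSpace X] [ReducedComplexSpace X]
  [TopologicalSpace Y] [ReducedComplexSpace Y]

/-- In local models, a holomorphic map is given by a holomorphic map of the ambient spaces. -/
theorem IsHolomorphic.exists_analyticAt {f : X → Y} (hf : IsHolomorphic f) {m n : ℕ}
    {U : Set X} {e : X → Fin m → ℂ} {Ω A : Set (Fin m → ℂ)}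
    {V : Set Y} {d : Y → Fin n → ℂ} {Ω' A' : Set (Fin n → ℂ)}
    (h : IsLocalModel (IsHolAt (X := X)) U e Ω A) (h' : IsLocalModel (IsHolAt (X := Y)) V d Ω' A')
    {x : X} (hx : x ∈ U) (hfx : f x ∈ V) :
    ∃ F : (Fin m → ℂ) → Fin n → ℂ, AnalyticAt ℂ F (e x) ∧ ∀ᶠ y in 𝓝 x, d (f y) = F (e y) := by
  have hi : ∀ i, ∃ G : (Fin m → ℂ) → ℂ, AnalyticAt ℂ G (e x) ∧
      (fun y => d (f y) i) =ᶠ[𝓝 x] fun y => G (e y) := fun i =>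
    (h.hol_iff x hx _).1 (hf.2 x _ (h'.isHolAt_apply hfx i))
  choose G hG hGe using hi
  refine ⟨fun z i => G i z, analyticAt_pi_iff.2 hG, ?_⟩
  filter_upwards [eventually_all.2 hGe] with y hy
  exact funext hy

theorem IsHolOneParam.exists_analyticAt {φ : Multiplicative ℂ →* HolAut X} (hφ : IsHolOneParam φ)
    {n : ℕ} {U : Set X} {e : X → Fin n → ℂ} (h : IsCoordinateSystem U e) {t : ℂ} {x : X}
    (hx : x ∈ U) (htx : φ (Multiplicative.ofAdd t) • x ∈ U) :
    ∃ F : ℂ × (Fin n → ℂ) → Fin n → ℂ, AnalyticAt ℂ F (t, e x) ∧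
      ∀ᶠ q : ℂ × X in 𝓝 (t, x), e (φ (Multiplicative.ofAdd q.1) • q.2) = F (q.1, e q.2) := by
  obtain ⟨F, hF, hFe⟩ := IsHolomorphic.exists_analyticAt (Y := X) hφ (isLocalModel_prod h) h
    (x := (t, x)) ⟨mem_univ _, hx⟩ htx
  refine ⟨fun q => F (Fin.cons q.1 q.2), ?_, hFe⟩
  exact AnalyticAt.fun_comp (g := F)
    (f := fun q : ℂ × (Fin n → ℂ) => (Fin.cons q.1 q.2 : Fin (n + 1) → ℂ)) hF (analyticAt_finCons _)

theorem IsHolOneParam.continuous {φ : Multiplicative ℂ →* HolAut X} (hφ : IsHolOneParam φ) :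
    Continuous fun q : ℂ × X => φ (Multiplicative.ofAdd q.1) • q.2 := hφ.1

theorem continuous_smul (g : HolAut X) : Continuous fun x : X => g • x := g.2.1.1

instance : ContinuousConstSMul (HolAut X) X := ⟨continuous_smul⟩

theorem IsHolOneParam.continuous_left {φ : Multiplicative ℂ →* HolAut X} (hφ : IsHolOneParam φ)
    (x : X) : Continuous fun t : ℂ => φ (Multiplicative.ofAdd t) • x :=
  hφ.continuous.comp (Continuous.prodMk_left x)

/-- The conjugate of a one-parameter subgroup by an automorphism. -/
def conjOneParam (g : HolAut X) (φ : Multiplicative ℂ →* HolAut X) :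
    Multiplicative ℂ →* HolAut X :=
  (MulAut.conj g).toMonoidHom.comp φ

theorem conjOneParam_apply (g : HolAut X) (φ : Multiplicative ℂ →* HolAut X)
    (t : Multiplicative ℂ) : conjOneParam g φ t = g * φ t * g⁻¹ := rfl

theorem isHolomorphic_prodMap_smul (g : HolAut X) :
    IsHolomorphic fun p : ℂ × X => ((p.1, g • p.2) : ℂ × X) := by
  refine ⟨continuous_fst.prodMk ((continuous_smul g).comp continuous_snd), ?_⟩
  rintro ⟨t, x⟩ f ⟨n, e, F, he, hF, hfF⟩
  refine ⟨n, fun y => e (g • y), F, fun i => g.2.1.2 x _ (he i), hF, ?_⟩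
  have hc : Continuous fun p : ℂ × X => ((p.1, g • p.2) : ℂ × X) :=
    continuous_fst.prodMk ((continuous_smul g).comp continuous_snd)
  exact (hc.tendsto (t, x)).eventually hfF

theorem IsHolOneParam.conj {φ : Multiplicative ℂ →* HolAut X} (hφ : IsHolOneParam φ)
    (g : HolAut X) : IsHolOneParam (conjOneParam g φ) :=
  IsHolomorphic.comp (show IsHolomorphic fun x : X => g • x from g.2.1)
    (hφ.comp (isHolomorphic_prodMap_smul g⁻¹))

theorem apply_ofAdd_zero (φ : Multiplicative ℂ →* HolAut X) : φ (Multiplicative.ofAdd 0) = 1 := by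
  rw [ofAdd_zero, map_one]

theorem apply_ofAdd_add (φ : Multiplicative ℂ →* HolAut X) (s t : ℂ) :
    φ (Multiplicative.ofAdd (s + t)) =
      φ (Multiplicative.ofAdd s) * φ (Multiplicative.ofAdd t) := by
  rw [ofAdd_add, map_mul]

theorem IsHolOneParam.mem_specialHolAut {φ : Multiplicative ℂ →* HolAut X} (hφ : IsHolOneParam φ)
    (t : Multiplicative ℂ) : φ t ∈ SpecialHolAut X :=
  Subgroup.subset_closure ⟨φ, hφ, t, rfl⟩

/-- A coordinate system on `U`, as a homeomorphism of `U` onto an open subset of `ℂⁿ`. -/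
theorem IsCoordinateSystem.exists_openPartialHomeomorph [Nonempty X] {n : ℕ} {U : Set X}
    {e : X → Fin n → ℂ} (h : IsCoordinateSystem U e) :
    ∃ κ : OpenPartialHomeomorph X (Fin n → ℂ), κ.source = U ∧ (κ : X → Fin n → ℂ) = e := by
  have hinj : InjOn e U := fun a ha b hb hab =>
    congrArg Subtype.val (@IsEmbedding.injective _ _ _ _ _ h.isEmbedding ⟨a, ha⟩ ⟨b, hb⟩ hab)
  have hop : IsOpenEmbedding (U.domRestrict e) :=
    ⟨h.isEmbedding, by rw [Set.range_domRestrict]; exact h.isOpen_ambient⟩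
  exact ⟨OpenPartialHomeomorph.ofContinuousOpenRestrict (hinj.bijOn_image.toPartialEquiv e U (e '' U))
    (continuousOn_iff_continuous_domRestrict.2 h.isEmbedding.continuous) hop.isOpenMap
    h.isOpen_source, rfl, rfl⟩

/-- Automorphisms map coordinate systems to coordinate systems. -/
theorem IsCoordinateSystem.translate {n : ℕ} {U : Set X} {e : X → Fin n → ℂ}
    (h : IsCoordinateSystem U e) (g : HolAut X) :
    IsCoordinateSystem ((fun x => g • x) ⁻¹' U) fun x => e (g • x) := by
  have hsurj : Function.Surjective fun x : X => g • x := MulAction.surjective g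
  have him : (fun x => e (g • x)) '' ((fun x => g • x) ⁻¹' U) = e '' U := by
    rw [← image_image e (fun x : X => g • x), image_preimage_eq _ hsurj]
  unfold IsCoordinateSystem
  rw [him]
  refine ⟨h.isOpen_source.preimage (continuous_smul g), h.isOpen_ambient, h.analytic, him, ?_, ?_⟩
  · have hE : IsEmbedding fun x : X => g • x := (Homeomorph.smul g).isEmbedding
    have h1 : IsEmbedding fun x : ((fun x : X => g • x) ⁻¹' U) => (⟨g • x.1, x.2⟩ : U) :=
      IsEmbedding.of_comp (g := Subtype.val) (by fun_prop) (by fun_prop)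
        (hE.comp IsEmbedding.subtypeVal)
    exact h.isEmbedding.comp h1
  · intro x hx f
    have hback : IsHolAt f x ↔ IsHolAt (fun y => f (g⁻¹ • y)) (g • x) := by
      constructor
      · intro hf
        refine g.2.2.2 (g • x) f ?_
        have : (g : Equiv.Perm X).symm (g • x) = x := (g : Equiv.Perm X).symm_apply_apply x
        beta_reduce
        rwa [this]
      · intro hf
        have := g.2.1.2 x _ hf
        have hfun : (fun y => f (g⁻¹ • ((g : Equiv.Perm X) y))) = f := by
          funext y
          exact congrArg f (inv_smul_smul g y)
        rwa [hfun] at this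
    rw [hback, h.hol_iff (g • x) hx]
    refine exists_congr fun F => and_congr_right fun _ => ?_
    constructor
    · intro hF
      have := ((continuous_smul g).tendsto x).eventually hF
      filter_upwards [this] with y hy
      simpa using hy
    · intro hF
      have hc := (continuous_smul g⁻¹).tendsto (g • x)
      rw [inv_smul_smul] at hc
      filter_upwards [hc.eventually hF] with y hy
      simpa using hy

theorem smul_mem_regularLocus (g : HolAut X) {x : X} (hx : x ∈ regularLocus X) :
    g • x ∈ regularLocus X := by
  obtain ⟨n, U, e, hxU, h⟩ := hx
  exact ⟨n, _, _, by simpa using hxU, h.translate g⁻¹⟩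

/-! ### Composites of flows -/

/-- The composite `φ₁(t₁) ∘ ⋯ ∘ φᵣ(tᵣ)` of one-parameter subgroups at the times `t₁, …, tᵣ`. -/
def flowProd {r : ℕ} (φ : Fin r → Multiplicative ℂ →* HolAut X) (t : Fin r → ℂ) : HolAut X :=
  (List.ofFn fun i => φ i (Multiplicative.ofAdd (t i))).prod

theorem flowProd_of_isEmpty (φ : Fin 0 → Multiplicative ℂ →* HolAut X) (t : Fin 0 → ℂ) :
    flowProd φ t = 1 := by
  simp [flowProd]

theorem flowProd_succ {r : ℕ} (φ : Fin (r + 1) → Multiplicative ℂ →* HolAut X)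
    (t : Fin (r + 1) → ℂ) :
    flowProd φ t = φ 0 (Multiplicative.ofAdd (t 0)) * flowProd (Fin.tail φ) (Fin.tail t) := by
  simp [flowProd, List.ofFn_succ, Fin.tail]

theorem flowProd_zero {r : ℕ} (φ : Fin r → Multiplicative ℂ →* HolAut X) : flowProd φ 0 = 1 := by
  refine List.prod_eq_one fun g hg => ?_
  obtain ⟨i, rfl⟩ := (List.mem_ofFn' _ _).1 hg
  exact apply_ofAdd_zero _

theorem flowProd_single {r : ℕ} (φ : Fin r → Multiplicative ℂ →* HolAut X) (i : Fin r) (u : ℂ) :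
    flowProd φ (Pi.single i u) = φ i (Multiplicative.ofAdd u) := by
  induction r with
  | zero => exact i.elim0
  | succ r ih =>
    rw [flowProd_succ]
    refine Fin.cases ?_ (fun i => ?_) i
    · rw [Pi.single_eq_same, Pi.single, Fin.tail_update_zero]
      exact (congrArg _ (flowProd_zero _)).trans (mul_one _)
    · rw [Pi.single_eq_of_ne (Fin.succ_ne_zero i).symm, apply_ofAdd_zero, one_mul, Pi.single,
        Fin.tail_update_succ]
      exact ih (Fin.tail φ) i

theorem flowProd_mem {r : ℕ} {φ : Fin r → Multiplicative ℂ →* HolAut X}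
    (hφ : ∀ i, IsHolOneParam (φ i)) (t : Fin r → ℂ) : flowProd φ t ∈ SpecialHolAut X := by
  refine Subgroup.list_prod_mem _ fun g hg => ?_
  obtain ⟨i, rfl⟩ := (List.mem_ofFn' _ _).1 hg
  exact (hφ i).mem_specialHolAut _

/-- As a function of one of its times, a composite of flows is of the form `u ↦ a φᵢ(u) b`. -/
theorem exists_flowProd_update {r : ℕ} (φ : Fin r → Multiplicative ℂ →* HolAut X) (t : Fin r → ℂ)
    (i : Fin r) : ∃ a b : HolAut X, ∀ u,
      flowProd φ (Function.update t i u) = a * φ i (Multiplicative.ofAdd u) * b := by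
  induction r with
  | zero => exact i.elim0
  | succ r ih =>
    refine Fin.cases ?_ (fun i => ?_) i
    · refine ⟨1, flowProd (Fin.tail φ) (Fin.tail t), fun u => ?_⟩
      rw [flowProd_succ, Fin.tail_update_zero, Function.update_self, one_mul]
    · obtain ⟨a, b, hab⟩ := ih (Fin.tail φ) (Fin.tail t) i
      refine ⟨φ 0 (Multiplicative.ofAdd (t 0)) * a, b, fun u => ?_⟩
      rw [flowProd_succ, Fin.tail_update_succ, hab,
        Function.update_of_ne (Fin.succ_ne_zero i).symm]
      simp only [mul_assoc, Fin.tail]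

/-- Changing the time `tᵢ` of a composite of flows amounts to following the flow of a conjugate
of `φᵢ`. -/
theorem exists_isHolOneParam_flowProd_update {r : ℕ} {φ : Fin r → Multiplicative ℂ →* HolAut X}
    (hφ : ∀ i, IsHolOneParam (φ i)) (t : Fin r → ℂ) (i : Fin r) :
    ∃ χ : Multiplicative ℂ →* HolAut X, IsHolOneParam χ ∧ ∀ u u',
      flowProd φ (Function.update t i (u + u')) =
        χ (Multiplicative.ofAdd u') * flowProd φ (Function.update t i u) := by
  obtain ⟨a, b, hab⟩ := exists_flowProd_update φ t i
  refine ⟨conjOneParam a (φ i), (hφ i).conj a, fun u u' => ?_⟩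
  rw [hab, hab, conjOneParam_apply, add_comm, apply_ofAdd_add]
  group

theorem continuous_flowProd {r : ℕ} {φ : Fin r → Multiplicative ℂ →* HolAut X}
    (hφ : ∀ i, IsHolOneParam (φ i)) :
    Continuous fun p : (Fin r → ℂ) × X => flowProd φ p.1 • p.2 := by
  induction r with
  | zero => simpa only [flowProd_of_isEmpty, one_smul] using continuous_snd
  | succ r ih =>
    have h := ih (φ := Fin.tail φ) fun i => hφ i.succ
    have htail : Continuous fun t : Fin (r + 1) → ℂ => (Fin.tail t : Fin r → ℂ) :=
      continuous_pi fun i => continuous_apply i.succ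
    simp only [flowProd_succ, mul_smul]
    exact (hφ 0).continuous.comp (((continuous_apply 0).comp continuous_fst).prodMk
      (h.comp ((htail.comp continuous_fst).prodMk continuous_snd)))

/-- Composing on the left with one more flow, given by `F` in coordinates, preserves analyticity of a
composite of flows, given by `A` in coordinates. -/
theorem analyticAt_fin_succ {r n : ℕ} {A : (Fin r → ℂ) × (Fin n → ℂ) → Fin n → ℂ}
    {F : ℂ × (Fin n → ℂ) → Fin n → ℂ} {z : Fin n → ℂ} (hA : AnalyticAt ℂ A (0, z))
    (hAz : A (0, z) = z) (hF : AnalyticAt ℂ F (0, z)) :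
    AnalyticAt ℂ (fun p : (Fin (r + 1) → ℂ) × (Fin n → ℂ) =>
      F (p.1 0, A (Fin.tail p.1, p.2))) (0, z) := by
  have hsplit : AnalyticAt ℂ (fun p : (Fin (r + 1) → ℂ) × (Fin n → ℂ) => (p.1 0, Fin.tail p.1))
      (0, z) := AnalyticAt.fun_comp (analyticAt_finUncons _) analyticAt_fst
  have h0 : AnalyticAt ℂ (fun p : (Fin (r + 1) → ℂ) × (Fin n → ℂ) => p.1 0) (0, z) :=
    AnalyticAt.fun_comp analyticAt_fst hsplit
  have h1 : AnalyticAt ℂ (fun p : (Fin (r + 1) → ℂ) × (Fin n → ℂ) =>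
      ((Fin.tail p.1 : Fin r → ℂ), p.2)) (0, z) :=
    (AnalyticAt.fun_comp analyticAt_snd hsplit).prod analyticAt_snd
  have h2 := h0.prod (AnalyticAt.fun_comp (g := A)
    (f := fun p : (Fin (r + 1) → ℂ) × (Fin n → ℂ) => ((Fin.tail p.1 : Fin r → ℂ), p.2)) hA h1)
  refine AnalyticAt.fun_comp (g := F) (f := fun p : (Fin (r + 1) → ℂ) × (Fin n → ℂ) =>
      (p.1 0, A (Fin.tail p.1, p.2))) ?_ h2
  change AnalyticAt ℂ F (0, A (0, z))
  rwa [hAz]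

/-- In coordinates, composites of flows are holomorphic functions of times and starting point. -/
theorem analyticAt_flowProd {r n : ℕ} {φ : Fin r → Multiplicative ℂ →* HolAut X}
    (hφ : ∀ i, IsHolOneParam (φ i)) {κ : OpenPartialHomeomorph X (Fin n → ℂ)}
    (h : IsCoordinateSystem κ.source κ) {x : X} (hx : x ∈ κ.source) :
    AnalyticAt ℂ (fun p : (Fin r → ℂ) × (Fin n → ℂ) => κ (flowProd φ p.1 • κ.symm p.2))
      (0, κ x) := by
  induction r with
  | zero =>
    refine analyticAt_snd.congr ?_
    have h1 : ∀ᶠ p : (Fin 0 → ℂ) × (Fin n → ℂ) in 𝓝 (0, κ x), κ (κ.symm p.2) = p.2 :=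
      (continuous_snd.tendsto _).eventually (κ.eventually_right_inverse (κ.map_source hx))
    filter_upwards [h1] with p hp
    rw [flowProd_of_isEmpty, one_smul, hp]
  | succ r ih =>
    have h1 := ih (φ := Fin.tail φ) fun i => hφ i.succ
    obtain ⟨F, hF, hFe⟩ := (hφ 0).exists_analyticAt h (t := 0) hx
      (by rwa [apply_ofAdd_zero, one_smul])
    have htail : Continuous fun t : Fin (r + 1) → ℂ => (Fin.tail t : Fin r → ℂ) :=
      continuous_pi fun i => continuous_apply i.succ
    have hsymm : Tendsto (fun p : (Fin (r + 1) → ℂ) × (Fin n → ℂ) => κ.symm p.2)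
        (𝓝 (0, κ x)) (𝓝 x) :=
      (κ.tendsto_symm hx).comp (continuous_snd.tendsto ((0 : Fin (r + 1) → ℂ), κ x))
    have htail' : Tendsto (fun p : (Fin (r + 1) → ℂ) × (Fin n → ℂ) => (Fin.tail p.1 : Fin r → ℂ))
        (𝓝 (0, κ x)) (𝓝 0) :=
      (htail.comp continuous_fst).tendsto ((0 : Fin (r + 1) → ℂ), κ x)
    have hG : Tendsto (fun q : (Fin r → ℂ) × X => flowProd (Fin.tail φ) q.1 • q.2)
        (𝓝 (0, x)) (𝓝 x) := by
      have h2 := (continuous_flowProd (φ := Fin.tail φ) fun i => hφ i.succ).tendsto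
        ((0 : Fin r → ℂ), x)
      simpa only [flowProd_zero, one_smul] using h2
    have h0 : Tendsto (fun p : (Fin (r + 1) → ℂ) × (Fin n → ℂ) => p.1 0) (𝓝 (0, κ x)) (𝓝 0) :=
      ((continuous_apply 0).comp continuous_fst).tendsto ((0 : Fin (r + 1) → ℂ), κ x)
    have hcont := h0.prodMk_nhds (hG.comp (htail'.prodMk_nhds hsymm))
    have hA : κ (flowProd (Fin.tail φ) 0 • κ.symm (κ x)) = κ x := by
      rw [flowProd_zero, one_smul, κ.left_inv hx]
    refine (analyticAt_fin_succ h1 hA hF).congr ?_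
    filter_upwards [hcont.eventually hFe] with p hp
    rw [flowProd_succ, mul_smul]
    exact hp.symm

/-! ### The velocity spaces -/

theorem IsHolOneParam.exists_hasDerivAt {φ : Multiplicative ℂ →* HolAut X} (hφ : IsHolOneParam φ)
    {n : ℕ} {U : Set X} {e : X → Fin n → ℂ} (h : IsCoordinateSystem U e) {x : X} (hx : x ∈ U) :
    ∃ v ∈ velocities e x, HasDerivAt (fun t : ℂ => e (φ (Multiplicative.ofAdd t) • x)) v 0 := by
  obtain ⟨F, hF, hFe⟩ := hφ.exists_analyticAt h (t := 0) hx (by rwa [apply_ofAdd_zero, one_smul])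
  have hc : Tendsto (fun t : ℂ => (t, x)) (𝓝 0) (𝓝 (0, x)) :=
    (Continuous.prodMk_left x).tendsto 0
  have hd : DifferentiableAt ℂ (fun t : ℂ => e (φ (Multiplicative.ofAdd t) • x)) 0 := by
    have hG : DifferentiableAt ℂ (fun t : ℂ => F (t, e x)) 0 :=
      DifferentiableAt.comp (g := F) (f := fun t : ℂ => (t, e x)) 0 hF.differentiableAt
        (by fun_prop)
    exact hG.congr_of_eventuallyEq (hc.eventually hFe)
  exact ⟨_, ⟨φ, hφ, hd.hasDerivAt⟩, hd.hasDerivAt⟩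

/-- The differential of an automorphism maps velocities to velocities, because it maps the flow of
a one-parameter subgroup to the flow of a conjugate one-parameter subgroup. -/
theorem fderiv_mem_velocities {n : ℕ} {e : X → Fin n → ℂ} {F : (Fin n → ℂ) → Fin n → ℂ} {x : X}
    {g : HolAut X} (hF : AnalyticAt ℂ F (e x)) (hFe : ∀ᶠ y in 𝓝 x, e (g • y) = F (e y))
    {v : Fin n → ℂ} (hv : v ∈ velocities e x) : fderiv ℂ F (e x) v ∈ velocities e (g • x) := by
  obtain ⟨φ, hφ, hd⟩ := hv
  refine ⟨conjOneParam g φ, hφ.conj g, ?_⟩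
  have h0 : φ (Multiplicative.ofAdd 0) • x = x := by rw [apply_ofAdd_zero, one_smul]
  have hd' : HasDerivAt (fun t : ℂ => F (e (φ (Multiplicative.ofAdd t) • x)))
      (fderiv ℂ F (e x) v) 0 := by
    refine HasFDerivAt.comp_hasDerivAt (l := F)
      (f := fun t : ℂ => e (φ (Multiplicative.ofAdd t) • x)) 0 ?_ hd
    rw [h0]
    exact hF.differentiableAt.hasFDerivAt
  refine hd'.congr_of_eventuallyEq ?_
  have hc := (hφ.continuous_left x).tendsto 0
  rw [h0] at hc
  filter_upwards [hc.eventually hFe] with t ht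
  rw [← ht]
  change e ((g * φ (Multiplicative.ofAdd t) * g⁻¹) • g • x) = _
  rw [mul_smul, mul_smul, inv_smul_smul]

theorem finrank_span_velocities_le {n : ℕ} {κ : OpenPartialHomeomorph X (Fin n → ℂ)}
    (h : IsCoordinateSystem κ.source κ) {x : X} (g : HolAut X) (hx : x ∈ κ.source)
    (hgx : g • x ∈ κ.source) :
    Module.finrank ℂ (Submodule.span ℂ (velocities κ x)) ≤
      Module.finrank ℂ (Submodule.span ℂ (velocities κ (g • x))) := by
  obtain ⟨F, hF, hFe⟩ := IsHolomorphic.exists_analyticAt (X := X) (Y := X) g.2.1 h h hx hgx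
  obtain ⟨G, hG, hGe⟩ := IsHolomorphic.exists_analyticAt (X := X) (Y := X) (g⁻¹).2.1 h h hgx
    (by change g⁻¹ • g • x ∈ κ.source; rwa [inv_smul_smul])
  replace hFe : ∀ᶠ y in 𝓝 x, κ (g • y) = F (κ y) := hFe
  replace hGe : ∀ᶠ y in 𝓝 (g • x), κ (g⁻¹ • y) = G (κ y) := hGe
  have hGF : ∀ᶠ z in 𝓝 (κ x), G (F z) = z := by
    have h1 : ∀ᶠ y in 𝓝 x, G (F (κ y)) = κ y := by
      filter_upwards [hFe, ((continuous_smul g).tendsto x).eventually hGe] with y h1 h2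
      rw [← h1, ← h2, inv_smul_smul]
    filter_upwards [(κ.tendsto_symm hx).eventually h1,
      κ.eventually_right_inverse (κ.map_source hx)] with z h2 h3
    rwa [h3] at h2
  have hFx : F (κ x) = κ (g • x) := hFe.self_of_nhds.symm
  have hid : HasFDerivAt (fun z => G (F z))
      ((fderiv ℂ G (κ (g • x))).comp (fderiv ℂ F (κ x))) (κ x) := by
    refine HasFDerivAt.comp (g := G) (f := F) (κ x) ?_ hF.differentiableAt.hasFDerivAt
    rw [hFx]
    exact hG.differentiableAt.hasFDerivAt
  have hcomp := (hid.congr_of_eventuallyEq (f₁ := id) (hGF.mono fun z hz => hz.symm)).unique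
    (hasFDerivAt_id _)
  have hinj : Function.Injective (fderiv ℂ F (κ x)) := by
    refine Function.LeftInverse.injective (g := fderiv ℂ G (κ (g • x))) fun v => ?_
    exact DFunLike.congr_fun hcomp v
  rw [(Submodule.equivMapOfInjective (fderiv ℂ F (κ x)).toLinearMap hinj
    (Submodule.span ℂ (velocities κ x))).finrank_eq]
  refine Submodule.finrank_mono ?_
  rw [Submodule.map_span_le]
  exact fun v hv => Submodule.subset_span (fderiv_mem_velocities hF hFe hv)

/-- The dimension of the space spanned by the velocities is constant along the orbits of the
automorphism group. -/
theorem finrank_span_velocities_eq {n : ℕ} {κ : OpenPartialHomeomorph X (Fin n → ℂ)}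
    (h : IsCoordinateSystem κ.source κ) {x : X} (g : HolAut X) (hx : x ∈ κ.source)
    (hgx : g • x ∈ κ.source) :
    Module.finrank ℂ (Submodule.span ℂ (velocities κ (g • x))) =
      Module.finrank ℂ (Submodule.span ℂ (velocities κ x)) := by
  refine le_antisymm ?_ (finrank_span_velocities_le h g hx hgx)
  have h1 := finrank_span_velocities_le h g⁻¹ hgx (by rwa [inv_smul_smul])
  rwa [inv_smul_smul] at h1

/-! ### Flow boxes -/

/-- A flow box: a parametrization `(t, c) ↦ φ₁(t₁) ∘ ⋯ ∘ φᵣ(tᵣ) (σ c)` of an open subset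
of `X`, where `κ` is a coordinate system around this subset, the `φᵢ` are holomorphic one-parameter
subgroups, and `c` is a parameter in a transversal. -/
structure IsFlowBox {n r : ℕ} {C : Type*} [NormedAddCommGroup C] [NormedSpace ℂ C]
    (κ : OpenPartialHomeomorph X (Fin n → ℂ)) (φ : Fin r → Multiplicative ℂ →* HolAut X)
    (Θ : OpenPartialHomeomorph ((Fin r → ℂ) × C) X) (σ : C → X) : Prop where
  coord : IsCoordinateSystem κ.source κ
  oneParam : ∀ i, IsHolOneParam (φ i)
  target_subset : Θ.target ⊆ κ.source
  apply_eq : ∀ p ∈ Θ.source, Θ p = flowProd φ p.1 • σ p.2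
  exists_hasFDerivAt : ∀ p ∈ Θ.source, ∃ L : ((Fin r → ℂ) × C) ≃L[ℂ] (Fin n → ℂ),
    HasFDerivAt (fun q => κ (Θ q)) (L : ((Fin r → ℂ) × C) →L[ℂ] (Fin n → ℂ)) p

/-- Linearly independent velocities of one-parameter subgroups can be completed by any complement
of their span to a flow box, by the inverse function theorem. -/
theorem exists_isFlowBox {n r : ℕ} {κ : OpenPartialHomeomorph X (Fin n → ℂ)}
    (h : IsCoordinateSystem κ.source κ) {x : X} (hx : x ∈ κ.source)
    {φ : Fin r → Multiplicative ℂ →* HolAut X} (hφ : ∀ i, IsHolOneParam (φ i))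
    {v : Fin r → Fin n → ℂ}
    (hv : ∀ i, HasDerivAt (fun t : ℂ => κ (φ i (Multiplicative.ofAdd t) • x)) (v i) 0)
    (hli : LinearIndependent ℂ v) {C : Submodule ℂ (Fin n → ℂ)}
    (hC : IsCompl (Submodule.span ℂ (range v)) C) :
    ∃ (Θ : OpenPartialHomeomorph ((Fin r → ℂ) × C) X) (σ : C → X),
      IsFlowBox κ φ Θ σ ∧ 0 ∈ Θ.source ∧ Θ 0 = x ∧ σ 0 = x := by
  set σ : C → X := fun c => κ.symm (κ x + c) with hσ
  have hσ0 : σ 0 = x := by simp [hσ, κ.left_inv hx]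
  set Ψ : (Fin r → ℂ) × C → Fin n → ℂ := fun p => κ (flowProd φ p.1 • σ p.2) with hΨ
  have hA : AnalyticAt ℂ Ψ 0 := by
    have h1 := analyticAt_flowProd hφ h hx
    have h2 : AnalyticAt ℂ (fun p : (Fin r → ℂ) × C => (p.1, κ x + (p.2 : Fin n → ℂ))) 0 :=
      analyticAt_fst.prod (analyticAt_const.add
        (((C.subtypeL).analyticAt _).comp analyticAt_snd))
    refine AnalyticAt.fun_comp (g := fun p : (Fin r → ℂ) × (Fin n → ℂ) =>
      κ (flowProd φ p.1 • κ.symm p.2)) ?_ h2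
    simpa using h1
  -- the differential at the origin is `(t, c) ↦ ∑ tᵢ vᵢ + c`
  have hbij : Function.Bijective (fderiv ℂ Ψ 0) := by
    have hD := hA.differentiableAt.hasFDerivAt
    have hDi : ∀ i, fderiv ℂ Ψ 0 (Pi.single i 1, 0) = v i := by
      intro i
      have hl : HasDerivAt (fun u : ℂ => ((Pi.single i u, 0) : (Fin r → ℂ) × C))
          (Pi.single i 1, 0) 0 := by
        refine HasDerivAt.prodMk ?_ (hasDerivAt_const _ _)
        exact hasDerivAt_single i 0
      have h1 : HasDerivAt (fun u : ℂ => Ψ (Pi.single i u, 0))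
          (fderiv ℂ Ψ 0 (Pi.single i 1, 0)) 0 := by
        refine HasFDerivAt.comp_hasDerivAt (l := Ψ)
          (f := fun u : ℂ => ((Pi.single i u, 0) : (Fin r → ℂ) × C)) 0 ?_ hl
        rw [Pi.single_zero]
        exact hD
      refine h1.unique ((hv i).congr_of_eventuallyEq (Eventually.of_forall fun u => ?_))
      simp only [hΨ, hσ0]
      rw [flowProd_single]
    have hDc : ∀ c : C, fderiv ℂ Ψ 0 (0, c) = c := by
      intro c
      have hl : HasDerivAt (fun u : ℂ => ((0, u • c) : (Fin r → ℂ) × C)) (0, c) 0 := by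
        refine HasDerivAt.prodMk (hasDerivAt_const _ _) ?_
        simpa using (hasDerivAt_id (0 : ℂ)).smul_const c
      have h1 : HasDerivAt (fun u : ℂ => Ψ (0, u • c)) (fderiv ℂ Ψ 0 (0, c)) 0 := by
        refine HasFDerivAt.comp_hasDerivAt (l := Ψ)
          (f := fun u : ℂ => ((0, u • c) : (Fin r → ℂ) × C)) 0 ?_ hl
        rw [zero_smul]
        exact hD
      have h2 : HasDerivAt (fun u : ℂ => κ x + u • (c : Fin n → ℂ)) (c : Fin n → ℂ) 0 := by
        simpa using ((hasDerivAt_id (0 : ℂ)).smul_const (c : Fin n → ℂ)).const_add (κ x)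
      have h3 : Tendsto (fun u : ℂ => κ x + u • (c : Fin n → ℂ)) (𝓝 0) (𝓝 (κ x)) := by
        simpa using h2.continuousAt.tendsto
      refine h1.unique (h2.congr_of_eventuallyEq ?_)
      filter_upwards [h3.eventually (κ.eventually_right_inverse (κ.map_source hx))] with u hu
      simp only [hΨ, hσ, flowProd_zero, one_smul, Submodule.coe_smul]
      exact hu
    have hform : ∀ p : (Fin r → ℂ) × C, fderiv ℂ Ψ 0 p = ∑ i, p.1 i • v i + p.2 := by
      rintro ⟨t, c⟩
      have ht : ((t, c) : (Fin r → ℂ) × C) = ∑ i, t i • (Pi.single i 1, 0) + (0, c) := by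
        refine Prod.ext ?_ ?_
        · simpa [Prod.fst_sum] using pi_eq_sum_univ' t
        · simp [Prod.snd_sum]
      rw [ht, map_add, hDc, map_sum]
      simp only [map_smul, hDi]
      rw [← ht]
    constructor
    · rw [injective_iff_map_eq_zero]
      rintro ⟨t, c⟩ h0
      rw [hform] at h0
      have hmem : ∑ i, t i • v i ∈ Submodule.span ℂ (range v) :=
        Submodule.sum_mem _ fun i _ => Submodule.smul_mem _ _ (Submodule.subset_span ⟨i, rfl⟩)
      have hmemC : ∑ i, t i • v i ∈ C := by
        rw [eq_neg_of_add_eq_zero_left h0]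
        exact C.neg_mem c.2
      have hz : ∑ i, t i • v i = 0 := Submodule.disjoint_def.1 hC.disjoint _ hmem hmemC
      have ht : t = 0 := funext (Fintype.linearIndependent_iff.1 hli t hz)
      have hc : c = 0 := by simpa [hz] using h0
      rw [ht, hc]
      rfl
    · intro w
      obtain ⟨a, ha, c, hc, rfl⟩ := Submodule.mem_sup.1
        (hC.sup_eq_top ▸ Submodule.mem_top : w ∈ Submodule.span ℂ (range v) ⊔ C)
      obtain ⟨t, rfl⟩ := (Submodule.mem_span_range_iff_exists_fun ℂ).1 ha
      exact ⟨(t, ⟨c, hc⟩), hform _⟩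
  obtain ⟨L₀, hL₀⟩ : ∃ L₀ : ((Fin r → ℂ) × C) ≃L[ℂ] (Fin n → ℂ),
      (L₀ : ((Fin r → ℂ) × C) →L[ℂ] (Fin n → ℂ)) = fderiv ℂ Ψ 0 :=
    ⟨(LinearEquiv.ofBijective (fderiv ℂ Ψ 0).toLinearMap hbij).toContinuousLinearEquiv,
      by ext p <;> rfl⟩
  have hstrict : HasStrictFDerivAt Ψ (L₀ : ((Fin r → ℂ) × C) →L[ℂ] (Fin n → ℂ)) 0 := by
    rw [hL₀]
    exact hA.hasStrictFDerivAt
  have hΨ0 : Ψ 0 = κ x := by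
    change κ (flowProd φ 0 • σ 0) = κ x
    rw [flowProd_zero, one_smul, hσ0]
  have hflow : ∀ᶠ p in 𝓝 (0 : (Fin r → ℂ) × C), flowProd φ p.1 • σ p.2 ∈ κ.source := by
    have h1 : Tendsto (fun p : (Fin r → ℂ) × C => κ x + (p.2 : Fin n → ℂ)) (𝓝 0) (𝓝 (κ x)) := by
      have : Continuous (fun p : (Fin r → ℂ) × C => κ x + (p.2 : Fin n → ℂ)) := by fun_prop
      simpa using this.tendsto 0
    have h2 : Tendsto (fun p : (Fin r → ℂ) × C => σ p.2) (𝓝 0) (𝓝 x) :=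
      (κ.tendsto_symm hx).comp h1
    have h3 : Tendsto (fun p : (Fin r → ℂ) × C => p.1) (𝓝 0) (𝓝 0) := continuous_fst.tendsto 0
    have h4 := (continuous_flowProd hφ).tendsto ((0 : Fin r → ℂ), x)
    simp only [flowProd_zero, one_smul] at h4
    exact (h4.comp (h3.prodMk_nhds h2)).eventually (κ.open_source.mem_nhds hx)
  have hinv : ∀ᶠ p in 𝓝 (0 : (Fin r → ℂ) × C), ∃ L : ((Fin r → ℂ) × C) ≃L[ℂ] (Fin n → ℂ),
      (L : ((Fin r → ℂ) × C) →L[ℂ] (Fin n → ℂ)) = fderiv ℂ Ψ p := by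
    have h1 := hA.fderiv.continuousAt.tendsto
    rw [← hL₀] at h1
    exact h1.eventually (ContinuousLinearEquiv.nhds L₀)
  have hgood : ∀ᶠ p in 𝓝 (0 : (Fin r → ℂ) × C), flowProd φ p.1 • σ p.2 ∈ κ.source ∧
      AnalyticAt ℂ Ψ p ∧ ∃ L : ((Fin r → ℂ) × C) ≃L[ℂ] (Fin n → ℂ),
        (L : ((Fin r → ℂ) × C) →L[ℂ] (Fin n → ℂ)) = fderiv ℂ Ψ p :=
    hflow.and (hA.eventually_analyticAt.and hinv)
  set S := {p : (Fin r → ℂ) × C | flowProd φ p.1 • σ p.2 ∈ κ.source ∧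
      AnalyticAt ℂ Ψ p ∧ ∃ L : ((Fin r → ℂ) × C) ≃L[ℂ] (Fin n → ℂ),
        (L : ((Fin r → ℂ) × C) →L[ℂ] (Fin n → ℂ)) = fderiv ℂ Ψ p}
  set Θ := ((hstrict.toOpenPartialHomeomorph Ψ).trans κ.symm).restr S with hΘ
  have hsrc : ∀ p ∈ Θ.source, p ∈ S := fun p hp => by
    rw [OpenPartialHomeomorph.restr_source] at hp
    exact interior_subset hp.2
  have happ : ∀ p ∈ Θ.source, Θ p = flowProd φ p.1 • σ p.2 := fun p hp =>
    κ.left_inv (hsrc p hp).1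
  have h0 : 0 ∈ Θ.source := by
    rw [OpenPartialHomeomorph.restr_source, OpenPartialHomeomorph.trans_source]
    refine ⟨⟨hstrict.mem_toOpenPartialHomeomorph_source, ?_⟩, mem_interior_iff_mem_nhds.2 hgood⟩
    change Ψ 0 ∈ κ.target
    rw [hΨ0]
    exact κ.map_source hx
  refine ⟨Θ, σ, ⟨h, hφ, ?_, happ, ?_⟩, h0, ?_, hσ0⟩
  · intro y hy
    rw [← Θ.right_inv hy, happ _ (Θ.map_target hy)]
    exact (hsrc _ (Θ.map_target hy)).1
  · intro p hp
    obtain ⟨-, hAp, L, hL⟩ := hsrc p hp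
    refine ⟨L, ?_⟩
    rw [hL]
    refine hAp.differentiableAt.hasFDerivAt.congr_of_eventuallyEq ?_
    filter_upwards [Θ.open_source.mem_nhds hp] with q hq
    rw [happ q hq]
  · rw [happ 0 h0]
    change flowProd φ 0 • σ 0 = x
    rw [flowProd_zero, one_smul, hσ0]

/-- The functions `c` of a flow box are locally constant along the flows of all one-parameter
subgroups, if the velocities span a space of the dimension `r` of the plaques: then this space
is the tangent space of the plaque. -/
theorem IsFlowBox.eventually_snd_eq {n r : ℕ} {C : Type*} [NormedAddCommGroup C] [NormedSpace ℂ C]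
    {κ : OpenPartialHomeomorph X (Fin n → ℂ)} {φ : Fin r → Multiplicative ℂ →* HolAut X}
    {Θ : OpenPartialHomeomorph ((Fin r → ℂ) × C) X} {σ : C → X} (hΘ : IsFlowBox κ φ Θ σ)
    (hrank : ∀ z ∈ Θ.target, Module.finrank ℂ (Submodule.span ℂ (velocities κ z)) = r)
    {χ : Multiplicative ℂ →* HolAut X} (hχ : IsHolOneParam χ) {y : X} (hy : y ∈ Θ.target) :
    ∀ᶠ u in 𝓝 (0 : ℂ), (Θ.symm (χ (Multiplicative.ofAdd u) • y)).2 = (Θ.symm y).2 := by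
  -- the velocities are tangent to the plaques
  have htangent : ∀ z ∈ Θ.target, ∀ L : ((Fin r → ℂ) × C) ≃L[ℂ] (Fin n → ℂ),
      HasFDerivAt (fun q => κ (Θ q)) (L : ((Fin r → ℂ) × C) →L[ℂ] (Fin n → ℂ)) (Θ.symm z) →
      ∀ v ∈ velocities κ z, (L.symm v).2 = 0 := by
    intro z hz L hL v hv
    set p := Θ.symm z
    have hp : p ∈ Θ.source := Θ.map_target hz
    have hi : ∀ i, L (Pi.single i 1, 0) ∈ velocities κ z := by
      intro i
      obtain ⟨ψ, hψ, hψe⟩ := exists_isHolOneParam_flowProd_update hΘ.oneParam p.1 i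
      refine ⟨ψ, hψ, ?_⟩
      have hl : HasDerivAt (fun u : ℂ => p + u • ((Pi.single i 1, 0) : (Fin r → ℂ) × C))
          (Pi.single i 1, 0) 0 := by
        simpa using ((hasDerivAt_id (0 : ℂ)).smul_const
          ((Pi.single i 1, 0) : (Fin r → ℂ) × C)).const_add p
      have h1 : HasDerivAt (fun u : ℂ => κ (Θ (p + u • ((Pi.single i 1, 0) : (Fin r → ℂ) × C))))
          (L (Pi.single i 1, 0)) 0 := by
        refine HasFDerivAt.comp_hasDerivAt (l := fun q => κ (Θ q))
          (l' := (L : ((Fin r → ℂ) × C) →L[ℂ] (Fin n → ℂ)))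
          (f := fun u : ℂ => p + u • ((Pi.single i 1, 0) : (Fin r → ℂ) × C)) 0 ?_ hl
        rw [zero_smul, add_zero]
        exact hL
      refine h1.congr_of_eventuallyEq ?_
      have h2 : Tendsto (fun u : ℂ => p + u • ((Pi.single i 1, 0) : (Fin r → ℂ) × C)) (𝓝 0)
          (𝓝 p) := by simpa using hl.continuousAt.tendsto
      filter_upwards [h2.eventually (Θ.open_source.mem_nhds hp)] with u hu
      have hupd : (p + u • ((Pi.single i 1, 0) : (Fin r → ℂ) × C)) =
          (Function.update p.1 i (p.1 i + u), p.2) := by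
        refine Prod.ext (funext fun j => ?_) (by simp)
        rcases eq_or_ne j i with rfl | hj
        · simp
        · simp [hj]
      rw [hupd] at hu ⊢
      rw [hΘ.apply_eq _ hu, hψe, Function.update_eq_self, mul_smul, ← hΘ.apply_eq p hp,
        Θ.right_inv hz]
      rfl
    have hrange : LinearMap.range (L.toLinearMap.comp (LinearMap.inl ℂ (Fin r → ℂ) C)) =
        Submodule.span ℂ (velocities κ z) := by
      refine Submodule.eq_of_le_of_finrank_eq ?_ ?_
      · rintro _ ⟨t, rfl⟩
        rw [pi_eq_sum_univ' t, map_sum]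
        refine Submodule.sum_mem _ fun i _ => ?_
        rw [map_smul]
        exact Submodule.smul_mem _ _ (Submodule.subset_span (hi i))
      · rw [hrank z hz, LinearMap.finrank_range_of_inj, Module.finrank_fin_fun]
        exact L.injective.comp LinearMap.inl_injective
    obtain ⟨t, rfl⟩ : v ∈ LinearMap.range (L.toLinearMap.comp (LinearMap.inl ℂ (Fin r → ℂ) C)) :=
      hrange ▸ Submodule.subset_span hv
    change (L.symm (L (t, 0))).2 = 0
    rw [L.symm_apply_apply]
  have hopen : IsOpen {u : ℂ | χ (Multiplicative.ofAdd u) • y ∈ Θ.target} :=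
    Θ.open_target.preimage (hχ.continuous_left y)
  have h0 : (0 : ℂ) ∈ {u : ℂ | χ (Multiplicative.ofAdd u) • y ∈ Θ.target} := by
    rw [mem_ofPred_eq, apply_ofAdd_zero, one_smul]
    exact hy
  obtain ⟨ε, hε, hball⟩ := Metric.isOpen_iff.1 hopen 0 h0
  have hderiv : ∀ u ∈ Metric.ball (0 : ℂ) ε,
      HasDerivAt (fun u : ℂ => (Θ.symm (χ (Multiplicative.ofAdd u) • y)).2) 0 u := by
    intro u hu
    set z := χ (Multiplicative.ofAdd u) • y with hz
    have hzΘ : z ∈ Θ.target := hball hu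
    have hzκ : z ∈ κ.source := hΘ.target_subset hzΘ
    obtain ⟨v, hv, hvd⟩ := hχ.exists_hasDerivAt hΘ.coord hzκ
    have hcurve : HasDerivAt (fun w : ℂ => κ (χ (Multiplicative.ofAdd w) • y)) v u := by
      rw [← sub_self u] at hvd
      refine (hvd.comp_sub_const u u).congr_of_eventuallyEq (Eventually.of_forall fun w => ?_)
      beta_reduce
      rw [hz, ← mul_smul, ← apply_ofAdd_add, sub_add_cancel]
    obtain ⟨L, hL⟩ := hΘ.exists_hasFDerivAt _ (Θ.map_target hzΘ)
    have hsymm : HasFDerivAt (fun w => Θ.symm (κ.symm w))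
        (L.symm : (Fin n → ℂ) →L[ℂ] ((Fin r → ℂ) × C)) (κ z) := by
      refine (Θ.trans κ).hasFDerivAt_symm ?_ ?_
      · rw [OpenPartialHomeomorph.trans_target]
        exact ⟨κ.map_source hzκ, by rw [mem_preimage, κ.left_inv hzκ]; exact hzΘ⟩
      · change HasFDerivAt (fun q => κ (Θ q)) _ (Θ.symm (κ.symm (κ z)))
        rwa [κ.left_inv hzκ]
    have h1 : HasDerivAt (fun w : ℂ => (Θ.symm (κ.symm (κ (χ (Multiplicative.ofAdd w) • y)))).2)
        (L.symm v).2 u :=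
      (HasFDerivAt.comp_hasDerivAt (l := fun w => Θ.symm (κ.symm w))
        (f := fun w : ℂ => κ (χ (Multiplicative.ofAdd w) • y)) u hsymm hcurve).snd
    rw [htangent z hzΘ L hL v hv] at h1
    refine h1.congr_of_eventuallyEq ?_
    filter_upwards [hopen.mem_nhds (hball hu)] with w hw
    rw [κ.left_inv (hΘ.target_subset hw)]
  filter_upwards [Metric.ball_mem_nhds (0 : ℂ) hε] with u hu
  have := Metric.isOpen_ball.is_const_of_deriv_eq_zero (convex_ball (0 : ℂ) ε).isPreconnected
    (fun w hw => (hderiv w hw).differentiableAt.differentiableWithinAt)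
    (fun w hw => (hderiv w hw).deriv) hu (Metric.mem_ball_self hε)
  simpa only [apply_ofAdd_zero, one_smul] using this

/-! ### Plaques and leaves -/

/-- An automorphism maps plaques to plaques locally: two points of one plaque are joined, within a
small box, by moving along flows of one-parameter subgroups, and the automorphism conjugates these
flows to flows of one-parameter subgroups. -/
theorem IsFlowBox.eventually_snd_smul_eq {n r : ℕ} {C : Type*} [NormedAddCommGroup C]
    [NormedSpace ℂ C] {κ : OpenPartialHomeomorph X (Fin n → ℂ)}
    {φ : Fin r → Multiplicative ℂ →* HolAut X}
    {Θ : OpenPartialHomeomorph ((Fin r → ℂ) × C) X} {σ : C → X} (hΘ : IsFlowBox κ φ Θ σ)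
    (hrank : ∀ z ∈ Θ.target, Module.finrank ℂ (Submodule.span ℂ (velocities κ z)) = r)
    (g : HolAut X) {p : X} (hp : p ∈ Θ.target) (hgp : g • p ∈ Θ.target) :
    ∀ᶠ z in 𝓝 p, (Θ.symm z).2 = (Θ.symm p).2 → (Θ.symm (g • z)).2 = (Θ.symm (g • p)).2 := by
  set t₀ := (Θ.symm p).1
  set c₀ := (Θ.symm p).2
  have hcont : Continuous fun t : Fin r → ℂ => g • flowProd φ t • σ c₀ :=
    (continuous_smul g).comp ((continuous_flowProd hΘ.oneParam).comp (Continuous.prodMk_left _))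
  have hopen : IsOpen {t : Fin r → ℂ | g • flowProd φ t • σ c₀ ∈ Θ.target} :=
    Θ.open_target.preimage hcont
  have hpt : ∀ z ∈ Θ.target, flowProd φ (Θ.symm z).1 • σ (Θ.symm z).2 = z := fun z hz => by
    rw [← hΘ.apply_eq _ (Θ.map_target hz), Θ.right_inv hz]
  have ht₀ : t₀ ∈ {t : Fin r → ℂ | g • flowProd φ t • σ c₀ ∈ Θ.target} := by
    rw [mem_ofPred_eq, hpt p hp]
    exact hgp
  obtain ⟨ε, hε, hball⟩ := Metric.isOpen_iff.1 hopen t₀ ht₀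
  rw [ball_pi _ hε] at hball
  set f : (Fin r → ℂ) → C := fun t => (Θ.symm (g • flowProd φ t • σ c₀)).2 with hf
  have hslice : ∀ t ∈ Set.pi univ (fun i => Metric.ball (t₀ i) ε), ∀ i,
      ∀ u ∈ Metric.ball (t₀ i) ε, f (Function.update t i u) = f t := by
    intro t ht i u hu
    obtain ⟨χ, hχ, hχe⟩ := exists_isHolOneParam_flowProd_update hΘ.oneParam t i
    have hloc : ∀ w ∈ Metric.ball (t₀ i) ε, ∀ᶠ w' in 𝓝[Metric.ball (t₀ i) ε] w,
        f (Function.update t i w') = f (Function.update t i w) := by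
      intro w hw
      refine Eventually.filter_mono nhdsWithin_le_nhds ?_
      have hmem : g • flowProd φ (Function.update t i w) • σ c₀ ∈ Θ.target := by
        refine hball fun j _ => ?_
        rcases eq_or_ne j i with rfl | hj
        · simpa using hw
        · simpa [hj] using ht j (mem_univ j)
      have h1 := hΘ.eventually_snd_eq hrank (hχ.conj g) hmem
      have h2 : Tendsto (fun w' : ℂ => w' - w) (𝓝 w) (𝓝 0) := by
        have : Continuous fun w' : ℂ => w' - w := by fun_prop
        simpa using this.tendsto w
      filter_upwards [h2.eventually h1] with w' hw'
      simp only [hf]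
      rw [← hw', conjOneParam_apply, mul_smul, mul_smul, inv_smul_smul, ← mul_smul (χ _), ← hχe,
        add_sub_cancel]
    have h3 := (convex_ball (t₀ i) ε).isPreconnected.eq_of_eventually_eq hloc hu
      (ht i (mem_univ i))
    rwa [Function.update_eq_self] at h3
  have hnear : ∀ᶠ z in 𝓝 p, (Θ.symm z).1 ∈ Set.pi univ (fun i => Metric.ball (t₀ i) ε) := by
    rw [← ball_pi _ hε]
    have h1 : Tendsto (fun z => (Θ.symm z).1) (𝓝 p) (𝓝 t₀) :=
      (continuous_fst.tendsto _).comp (Θ.continuousAt_symm hp)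
    exact h1.eventually (Metric.ball_mem_nhds t₀ hε)
  filter_upwards [hnear, Θ.open_target.mem_nhds hp] with z hz hzt hzc
  have h1 := eq_of_forall_update_eq hslice (t := t₀) (fun i _ => Metric.mem_ball_self hε) hz
  simp only [hf] at h1
  rw [← hzc, hpt z hzt, hzc, hpt p hp] at h1
  exact h1

/-- If the group generated by the one-parameter subgroups acts transitively on `X_reg`, a flow box
along which the velocities span the tangent spaces of the plaques has a trivial transversal. -/
theorem IsFlowBox.subsingleton_transversal [SecondCountableTopology X] {n r : ℕ} {C : Type*}
    [NormedAddCommGroup C] [NormedSpace ℂ C] {κ : OpenPartialHomeomorph X (Fin n → ℂ)}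
    {φ : Fin r → Multiplicative ℂ →* HolAut X}
    {Θ : OpenPartialHomeomorph ((Fin r → ℂ) × C) X} {σ : C → X} (hΘ : IsFlowBox κ φ Θ σ)
    (hrank : ∀ z ∈ Θ.target, Module.finrank ℂ (Submodule.span ℂ (velocities κ z)) = r)
    (h0 : 0 ∈ Θ.source) (htrans : ActsTransitivelyOn (SpecialHolAut X) (regularLocus X)) :
    Subsingleton C := by
  by_contra hC
  have : Nontrivial C := not_subsingleton_iff_nontrivial.1 hC
  set x := Θ 0
  have hreg : ∀ z ∈ Θ.target, z ∈ regularLocus X := fun z hz =>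
    ⟨n, κ.source, κ, hΘ.target_subset hz, hΘ.coord⟩
  have hxΘ : x ∈ Θ.target := Θ.map_source h0
  have hx : x ∈ regularLocus X := hreg x hxΘ
  have htr : ∀ y : regularLocus X, ∃ g : HolAut X, g • x = y := fun y => by
    obtain ⟨g, -, hg⟩ := htrans x hx y y.2
    exact ⟨g, hg⟩
  choose g hg using htr
  set V : regularLocus X → Set X := fun y => (fun z => (g y)⁻¹ • z) ⁻¹' Θ.target with hV
  have hVopen : ∀ y, IsOpen (V y) := fun y => Θ.open_target.preimage (continuous_smul _)
  have hVmem : ∀ y, (y : X) ∈ V y := fun y => by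
    rw [hV, mem_preimage, ← hg y, inv_smul_smul]
    exact hxΘ
  set s : regularLocus X → X → C := fun y z => (Θ.symm ((g y)⁻¹ • z)).2 with hs
  obtain ⟨t, ht, hcov⟩ := TopologicalSpace.countable_cover_nhds
    (f := fun y : regularLocus X => (Subtype.val ⁻¹' V y : Set (regularLocus X)))
    fun y => (continuous_subtype_val.tendsto y).eventually ((hVopen y).mem_nhds (hVmem y))
  have hcover : ∀ z ∈ regularLocus X, ∃ i : t, z ∈ V i := fun z hz => by
    obtain ⟨y, hy, hzy⟩ := mem_iUnion₂.1 (hcov ▸ mem_univ (⟨z, hz⟩ : regularLocus X))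
    exact ⟨⟨y, hy⟩, hzy⟩
  have : Countable t := ht
  have hcount : ∀ i j : t, ∀ c, (s j '' {z | z ∈ V i ∧ z ∈ V j ∧ s i z = c}).Countable := by
    intro i j c
    refine countable_image_of_eventually_eq ?_
    rintro p ⟨hpi, hpj, hpc⟩
    have hcancel : ∀ z : X, ((g j)⁻¹ * g i) • (g i)⁻¹ • z = (g j)⁻¹ • z := fun z => by
      rw [mul_smul, smul_inv_smul]
    have h1 := hΘ.eventually_snd_smul_eq hrank ((g j)⁻¹ * g i) hpi (by rw [hcancel]; exact hpj)
    have h2 := ((continuous_smul (g i)⁻¹).tendsto p).eventually h1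
    filter_upwards [h2.filter_mono nhdsWithin_le_nhds, self_mem_nhdsWithin] with z hz hzS
    simp only [hcancel] at hz
    exact hz (hzS.2.2.trans hpc.symm)
  obtain ⟨L, hxL, hLcount, hLsat⟩ := exists_countable_leaf hcount x
  -- the leaf `L` of `x` is invariant under all flows, since it is locally saturated along them
  have hflow : ∀ χ : Multiplicative ℂ →* HolAut X, IsHolOneParam χ → ∀ y ∈ regularLocus X,
      ∀ u : ℂ, (χ (Multiplicative.ofAdd u) • y ∈ L) = (y ∈ L) := by
    intro χ hχ y hy u
    have hloc : ∀ w ∈ (univ : Set ℂ), ∀ᶠ w' in 𝓝[univ] w,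
        (χ (Multiplicative.ofAdd w') • y ∈ L) = (χ (Multiplicative.ofAdd w) • y ∈ L) := by
      intro w _
      rw [nhdsWithin_univ]
      set z := χ (Multiplicative.ofAdd w) • y with hz
      obtain ⟨i, hi⟩ := hcover z (smul_mem_regularLocus _ hy)
      have h1 := hΘ.eventually_snd_eq hrank (hχ.conj (g i)⁻¹) hi
      have h2 : Tendsto (fun w' : ℂ => w' - w) (𝓝 w) (𝓝 0) := by
        have : Continuous fun w' : ℂ => w' - w := by fun_prop
        simpa using this.tendsto w
      have h3 := ((hχ.continuous_left y).tendsto w).eventually ((hVopen i).mem_nhds hi)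
      filter_upwards [h2.eventually h1, h3] with w' hw' hV'
      have h4 : conjOneParam (g i)⁻¹ χ (Multiplicative.ofAdd (w' - w)) • (g i)⁻¹ • z =
          (g i)⁻¹ • χ (Multiplicative.ofAdd w') • y := by
        rw [conjOneParam_apply, inv_inv, mul_smul, mul_smul, smul_inv_smul, hz,
          ← mul_smul (χ _) (χ _), ← apply_ofAdd_add, sub_add_cancel]
      rw [h4] at hw'
      exact propext ⟨hLsat i _ hV' _ hi hw', hLsat i _ hi _ hV' hw'.symm⟩
    have h5 := isPreconnected_univ.eq_of_eventually_eq hloc (mem_univ u) (mem_univ 0)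
    simpa only [apply_ofAdd_zero, one_smul] using h5
  have hinv : ∀ a ∈ SpecialHolAut X, ∀ y ∈ regularLocus X, (a • y ∈ L) = (y ∈ L) := by
    intro a ha
    induction ha using Subgroup.closure_induction with
    | mem a ha =>
      obtain ⟨χ, hχ, u, rfl⟩ := ha
      exact fun y hy => hflow χ hχ y hy u.toAdd
    | one => exact fun y _ => by rw [one_smul]
    | mul a b _ _ iha ihb =>
      exact fun y hy => by rw [mul_smul, iha _ (smul_mem_regularLocus b hy), ihb y hy]
    | inv a _ iha =>
      exact fun y hy => by rw [← iha _ (smul_mem_regularLocus a⁻¹ hy), smul_inv_smul]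
  have hL : regularLocus X ⊆ L := fun y hy => by
    obtain ⟨a, ha, hay⟩ := htrans x hx y hy
    have h1 := hinv a ha x hx
    rw [show a • x = y from hay] at h1
    exact h1.symm ▸ hxL
  -- hence a nonempty open subset of the transversal is countable
  obtain ⟨i, -⟩ := hcover x hx
  have hopen : IsOpen {c : C | ((0 : Fin r → ℂ), c) ∈ Θ.source} :=
    Θ.open_source.preimage (Continuous.prodMk_right _)
  have hcountable : {c : C | ((0 : Fin r → ℂ), c) ∈ Θ.source}.Countable := by
    refine (hLcount i).mono fun c hc => ?_
    have hmem : Θ (0, c) ∈ Θ.target := Θ.map_source hc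
    refine ⟨g i • Θ (0, c), ⟨hL (smul_mem_regularLocus _ (hreg _ hmem)), ?_⟩, ?_⟩
    · rw [hV, mem_preimage, inv_smul_smul]
      exact hmem
    · simp only [hs, inv_smul_smul, Θ.left_inv hc]
  obtain ⟨c, hc, hc'⟩ := (hcountable.dense_compl ℂ).inter_open_nonempty _ hopen ⟨0, h0⟩
  exact hc' hc

/-! ### Transitivity and flexibility -/

theorem IsCoordinateSystem.span_velocities_eq_top [SecondCountableTopology X] {n : ℕ}
    {κ : OpenPartialHomeomorph X (Fin n → ℂ)} (h : IsCoordinateSystem κ.source κ)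
    (htrans : ActsTransitivelyOn (SpecialHolAut X) (regularLocus X)) {x : X} (hx : x ∈ κ.source) :
    Submodule.span ℂ (velocities κ x) = ⊤ := by
  obtain ⟨v, hv, hspan, hli⟩ := Submodule.exists_fun_fin_finrank_span_eq ℂ (velocities κ x)
  choose φ hφ hφv using hv
  obtain ⟨C, hC⟩ := Submodule.exists_isCompl (Submodule.span ℂ (range v))
  obtain ⟨Θ, σ, hΘ, h0, -, -⟩ := exists_isFlowBox h hx hφ hφv hli hC
  have hreg : ∀ z ∈ κ.source, z ∈ regularLocus X := fun z hz => ⟨n, κ.source, κ, hz, h⟩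
  have hsub := hΘ.subsingleton_transversal (fun z hz => by
    obtain ⟨g, -, hg⟩ := htrans x (hreg x hx) z (hreg z (hΘ.target_subset hz))
    replace hg : g • x = z := hg
    subst hg
    exact finrank_span_velocities_eq h g hx (hΘ.target_subset hz)) h0 htrans
  rw [← hspan, ← hC.sup_eq_top, (Submodule.subsingleton_iff_eq_bot).1 hsub, sup_bot_eq]

/-- At a flexible point, the orbit of the group generated by the one-parameter subgroups is a
neighbourhood. -/
theorem IsHolFlexibleAt.eventually_mem_orbit {x : X} (hflex : IsHolFlexibleAt x)
    (hx : x ∈ regularLocus X) : ∀ᶠ y in 𝓝 x, ∃ g ∈ SpecialHolAut X, g • x = y := by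
  have : Nonempty X := ⟨x⟩
  obtain ⟨n, U, e, hxU, h⟩ := hx
  obtain ⟨κ, rfl, rfl⟩ := h.exists_openPartialHomeomorph
  obtain ⟨v, hv, hspan, hli⟩ := Submodule.exists_fun_fin_finrank_span_eq ℂ (velocities κ x)
  choose φ hφ hφv using hv
  have hC : IsCompl (Submodule.span ℂ (range v)) (⊥ : Submodule ℂ (Fin n → ℂ)) := by
    rw [hspan, hflex n _ _ hxU h]
    exact isCompl_top_bot
  obtain ⟨Θ, σ, hΘ, h0, hΘ0, hσ⟩ := exists_isFlowBox h hxU hφ hφv hli hC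
  have hxΘ : x ∈ Θ.target := by
    have h1 := Θ.map_source h0
    rwa [hΘ0] at h1
  filter_upwards [Θ.open_target.mem_nhds hxΘ] with y hy
  refine ⟨flowProd φ (Θ.symm y).1, flowProd_mem hφ _, ?_⟩
  have hσx : σ (Θ.symm y).2 = x := by rw [Subsingleton.elim (Θ.symm y).2 0, hσ]
  have h1 := hΘ.apply_eq _ (Θ.map_target hy)
  rw [Θ.right_inv hy, hσx] at h1
  exact h1.symm

theorem IsHolFlexible.actsTransitivelyOn (hX : IsIrreducible X) (hflex : IsHolFlexible X) :
    ActsTransitivelyOn (SpecialHolAut X) (regularLocus X) := by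
  intro x hx y hy
  let orbit : X → Set X := fun x => {y | ∃ g ∈ SpecialHolAut X, g • x = y}
  have hloc : ∀ z ∈ regularLocus X, ∀ᶠ w in 𝓝[regularLocus X] z, orbit w = orbit z := by
    intro z hz
    filter_upwards [((hflex z hz).eventually_mem_orbit hz).filter_mono nhdsWithin_le_nhds]
      with w ⟨a, ha, haw⟩
    subst haw
    ext q
    constructor
    · rintro ⟨b, hb, rfl⟩
      exact ⟨b * a, mul_mem hb ha, mul_smul _ _ _⟩
    · rintro ⟨b, hb, rfl⟩
      exact ⟨b * a⁻¹, mul_mem hb (inv_mem ha), by rw [mul_smul, inv_smul_smul]⟩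
  have hmem : y ∈ orbit y := ⟨1, one_mem _, one_smul _ _⟩
  rw [← hX.isPreconnected.eq_of_eventually_eq hloc hx hy] at hmem
  exact hmem

theorem isHolFlexible_of_actsTransitivelyOn [SecondCountableTopology X]
    (htrans : ActsTransitivelyOn (SpecialHolAut X) (regularLocus X)) : IsHolFlexible X := by
  intro x _ n U e hxU h
  have : Nonempty X := ⟨x⟩
  obtain ⟨κ, rfl, rfl⟩ := h.exists_openPartialHomeomorph
  exact h.span_velocities_eq_top htrans hxU

end ReducedComplexSpace

theorem mainTheorem9 {X : Type*} [TopologicalSpace X] [T2Space X] [SecondCountableTopology X]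
    [ReducedComplexSpace X] (hX : ReducedComplexSpace.IsIrreducible X) :
    (ReducedComplexSpace.IsHolFlexible X ↔
      ReducedComplexSpace.ActsTransitivelyOn (ReducedComplexSpace.SpecialHolAut X)
        (ReducedComplexSpace.regularLocus X)) ∧
    (ReducedComplexSpace.IsHolFlexible X →
      ReducedComplexSpace.ActsTransitivelyOn (⊤ : Subgroup (ReducedComplexSpace.HolAut X))
        (ReducedComplexSpace.regularLocus X)) := by
  refine ⟨⟨fun h => h.actsTransitivelyOn hX,
    ReducedComplexSpace.isHolFlexible_of_actsTransitivelyOn⟩, fun h x hx y hy => ?_⟩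
  obtain ⟨g, -, hg⟩ := h.actsTransitivelyOn hX x hx y hy
  exact ⟨g, Subgroup.mem_top g, hg⟩
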